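/- Let $K\subset\mathbb{R}^n$ be a compact convex body containing the origin in its interior. For $p\in\operatorname{int}K$ let $L_p$ be the Minkowski functional of $K$ with base point $p$, i.e. $L_p(0)=0$ and, for $v\neq 0$, $L_p(v)$ is the positive number with $p+v/L_p(v)\in\partial K$; write $L=L_0$. Assume that $L$ is a Finsler–Minkowski functional: it is of class $C^4$ on $\mathbb{R}^n\setminus\{0\}$ and the Hessian matrix of $\frac12L^2$ is positive definite at every non-zero vector. Let $K_p=K-p$ be the unit ball of $L_p$, let $g_{ij}=\frac{\partial^2}{\partial y^j\partial y^i}\big(\frac12L_p^2\big)$, and let $$\mu_p=\sqrt{\det g_{ij}}\,\sum_{i=1}^n(-1)^{i-1}y^i\,dy^1\wedge\dots\wedge\widehat{dy^i}\wedge\dots\wedge dy^n$$ be the induced volume form on the indicatrix $\partial K_p=L_p^{-1}(1)$ (oriented outwards). The area function of the Funk metric is $r(p)=\int_{\partial K_p}1\,\mu_p$, $p\in\operatorname{int}K$. Put $c_0=1$ and $c_m=\frac{(n-1)(n+1)\cdots((n-1)+2(m-1))}{2^m}$ for $m\ge1$. Then $r$ is real-analytic at the origin; for all integers $i_1,\dots,i_n\ge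 0$ with $i_1+\dots+i_n=m$, $$\frac{\partial^m r}{(\partial u^1)^{i_1}\cdots(\partial u^n)^{i_n}}(0)=c_m\int_{\partial K}\Big(\frac{\partial L}{\partial y^1}\Big)^{i_1}\cdots\Big(\frac{\partial L}{\partial y^n}\Big)^{i_n}\mu_0;$$ and for every point $p=(p_1,\dots,p_n)$ in the interior of $K\cap(-K)$ $$r(p)=r(0)+\sum_{m=1}^\infty\ \sum_{i_1+\dots+i_n=m}\frac{1}{i_1!\cdots i_n!}\,\frac{\partial^m r}{(\partial u^1)^{i_1}\cdots(\partial u^n)^{i_n}}(0)\;p_1^{i_1}\cdots p_n^{i_n}.$$ In particular, if $K=-K$, then $r$ is real-analytic on the whole interior of $K$. -/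

import Mathlib

open MeasureTheory Metric
open scoped Pointwise Nat

noncomputable section

/-- The partial derivative `∂f/∂y^j`, as a function on `ℝⁿ`. -/
def partialDeriv {n : ℕ} (j : Fin n) (f : EuclideanSpace ℝ (Fin n) → ℝ) :
    EuclideanSpace ℝ (Fin n) → ℝ :=
  fun y => lineDeriv ℝ f y (EuclideanSpace.single j 1)

/-- The mixed partial derivative `∂^{i₁ + ⋯ + iₙ} f / (∂u¹)^{i₁} ⋯ (∂uⁿ)^{iₙ}`. -/
def mixedPartial {n : ℕ} (i : Fin n → ℕ) (f : EuclideanSpace ℝ (Fin n) → ℝ) :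
    EuclideanSpace ℝ (Fin n) → ℝ :=
  (List.finRange n).foldr (fun j h => (partialDeriv j)^[i j] h) f

/-- The energy function `E = L² / 2` of a functional `L`. -/
def energy {n : ℕ} (L : EuclideanSpace ℝ (Fin n) → ℝ) : EuclideanSpace ℝ (Fin n) → ℝ :=
  fun y => (1 / 2) * L y ^ 2

/-- The matrix `g_{ij}(y) = ∂²E / ∂y^j ∂y^i`. -/
def metricMatrix {n : ℕ} (L : EuclideanSpace ℝ (Fin n) → ℝ) (y : EuclideanSpace ℝ (Fin n)) :
    Matrix (Fin n) (Fin n) ℝ :=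
  Matrix.of fun i j => partialDeriv j (partialDeriv i (energy L)) y

/-- `K` is a convex body containing the origin in its interior, and its Minkowski functional
`L = gauge K` is a Finsler-Minkowski functional: it is of class `C⁴` around each non-zero vector,
and the Hessian matrix of `L² / 2` is positive definite there. -/
structure IsFinslerMinkowskiBody {n : ℕ} (K : Set (EuclideanSpace ℝ (Fin n))) : Prop where
  convex : Convex ℝ K
  isCompact : IsCompact K
  zero_mem_interior : 0 ∈ interior K
  contDiffAt : ∀ v, v ≠ 0 → ContDiffAt ℝ 4 (gauge K) v
  posDef : ∀ v, v ≠ 0 → (metricMatrix (gauge K) v).PosDef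

/-- The radial parametrization `u ↦ u / L(u)` of the indicatrix `L⁻¹(1)` by the unit sphere. -/
def radialMap {n : ℕ} (L : EuclideanSpace ℝ (Fin n) → ℝ) :
    EuclideanSpace ℝ (Fin n) → EuclideanSpace ℝ (Fin n) :=
  fun u => (L u)⁻¹ • u

/-- For a unit vector `u`, the linear map that sends `u` to `ψ(u)` and each `e ⟂ u` to `dψ_u(e)`.
If `u, e₂, …, eₙ` is a positively oriented orthonormal basis, then its determinant is
`det (ψ(u), dψ_u(e₂), …, dψ_u(eₙ))`: the value on `(e₂, …, eₙ)` of the pull-back by `ψ` of the form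
`ι_C (dy¹ ∧ ⋯ ∧ dyⁿ) = ∑ (-1)^{i-1} y^i dy¹ ∧ ⋯ (dy^i omitted) ⋯ ∧ dyⁿ`. -/
def frameMap {n : ℕ} (ψ : EuclideanSpace ℝ (Fin n) → EuclideanSpace ℝ (Fin n))
    (u : EuclideanSpace ℝ (Fin n)) : EuclideanSpace ℝ (Fin n) →L[ℝ] EuclideanSpace ℝ (Fin n) :=
  (innerSL ℝ u).smulRight (ψ u) +
    (fderiv ℝ ψ u).comp
      (ContinuousLinearMap.id ℝ (EuclideanSpace ℝ (Fin n)) - (innerSL ℝ u).smulRight u)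

/-- The integral `∫ f μ` over the indicatrix hypersurface `L⁻¹(1)` (oriented outwards) of a function
`f` against the form `μ = √(det g_{ij}) ∑ (-1)^{i-1} y^i dy¹ ∧ ⋯ (dy^i omitted) ⋯ ∧ dyⁿ`.
As usual for differential forms, it is computed by pulling `f μ` back along a parametrization,
here the diffeomorphism `u ↦ u / L(u)` of the Euclidean unit sphere onto the indicatrix;
`volume.toSphere` is the standard surface measure of the unit sphere. -/
def indicatrixIntegral {n : ℕ} (L f : EuclideanSpace ℝ (Fin n) → ℝ) : ℝ :=
  ∫ u : sphere (0 : EuclideanSpace ℝ (Fin n)) 1,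
    f (radialMap L u) * √(metricMatrix L (radialMap L u)).det * (frameMap (radialMap L) u).det
    ∂(volume : Measure (EuclideanSpace ℝ (Fin n))).toSphere

/-- The functional `L_p` of the Funk metric: the Minkowski functional of the body `K` seen from the
base point `p`, that is `p + v / L_p(v) ∈ ∂K` for `v ≠ 0`. -/
def funkFunctional {n : ℕ} (K : Set (EuclideanSpace ℝ (Fin n))) (p : EuclideanSpace ℝ (Fin n)) :
    EuclideanSpace ℝ (Fin n) → ℝ :=
  gauge {v | p + v ∈ K}

/-- The area function `r(p) = ∫_{∂K_p} 1 μ_p` of the Funk metric (meaningful for `p ∈ int K`). -/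
def funkArea {n : ℕ} (K : Set (EuclideanSpace ℝ (Fin n))) (p : EuclideanSpace ℝ (Fin n)) : ℝ :=
  indicatrixIntegral (funkFunctional K p) (fun _ => 1)

/-- `c_m = (n-1)(n+1) ⋯ ((n-1) + 2(m-1)) / 2^m`, with `c_0 = 1`. -/
def areaCoeff (n m : ℕ) : ℝ :=
  (∏ k ∈ Finset.range m, ((n : ℝ) - 1 + 2 * (k : ℝ))) / 2 ^ m

end

section BinomialIntegral

open Filter Topology

theorem choose_add_sub_one_eq_prod_div (a : ℝ) (m : ℕ) :
    Ring.choose (a + m - 1) m = (∏ k ∈ Finset.range m, (a + k)) / m ! := by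
  have h1 : Ring.choose (a + m - 1) m = Ring.multichoose a m := by
    rw [Ring.choose]; congr 1; ring
  have h2 := Ring.factorial_nsmul_multichoose_eq_ascPochhammer a m
  rw [Polynomial.ascPochhammer_smeval_eq_eval, nsmul_eq_mul] at h2
  rw [h1, eq_div_iff (by positivity), mul_comm, h2]
  clear h1 h2
  induction m with
  | zero => simp
  | succ m ih => rw [ascPochhammer_succ_eval, ih, Finset.prod_range_succ]

/-- The Taylor coefficients of `(1 - t) ^ (-b)` at `0`. -/
noncomputable def negBinomialCoeff (b : ℝ) (m : ℕ) : ℝ := (∏ k ∈ Finset.range m, (b + k)) / m !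

theorem hasFPowerSeriesOnBall_negBinomial (b : ℝ) :
    HasFPowerSeriesOnBall (fun x : ℝ => (1 - x) ^ (-b))
      (.ofScalars ℝ (negBinomialCoeff b)) 0 1 := by
  have h := Real.one_div_one_sub_rpow_hasFPowerSeriesOnBall_zero b
  have e : (fun n : ℕ => Ring.choose (b + n - 1) n) = negBinomialCoeff b := by
    funext n; exact choose_add_sub_one_eq_prod_div b n
  rw [e] at h
  refine h.congr fun x hx => ?_
  have hx' : |x| < 1 := by simpa [enorm_eq_nnnorm] using! hx
  have : 0 ≤ 1 - x := by linarith [le_abs_self x]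
  simp [Real.rpow_neg this]

theorem hasSum_negBinomial (b : ℝ) {t : ℝ} (ht : |t| < 1) :
    HasSum (fun m => negBinomialCoeff b m * t ^ m) ((1 - t) ^ (-b)) := by
  have h := (hasFPowerSeriesOnBall_negBinomial b).hasSum (y := t)
    (by simpa [enorm_eq_nnnorm] using! ht)
  simpa [FormalMultilinearSeries.ofScalars_apply_eq, mul_comm] using h

theorem summable_abs_negBinomialCoeff_mul_pow (b : ℝ) {t : ℝ} (h0 : 0 ≤ t) (ht : t < 1) :
    Summable (fun m => |negBinomialCoeff b m| * t ^ m) := by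
  have h := (hasFPowerSeriesOnBall_negBinomial b).r_le
  lift t to NNReal using h0
  have h2 := FormalMultilinearSeries.summable_norm_mul_pow
    (FormalMultilinearSeries.ofScalars ℝ (negBinomialCoeff b)) (r := t)
    (lt_of_lt_of_le (by exact_mod_cast ht) h)
  simpa [FormalMultilinearSeries.ofScalars_norm] using h2

variable {X : Type*} [TopologicalSpace X] {E : Type*} [NormedAddCommGroup E] [NormedSpace ℝ E]

/-- The function `x ↦ ℓ x p`, for a continuous family `ℓ` of linear forms. -/
noncomputable def ContinuousMap.evalForms (ℓ : C(X, E →L[ℝ] ℝ)) (p : E) : C(X, ℝ) :=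
  ⟨fun x => ℓ x p, by fun_prop⟩

theorem ContinuousMap.evalForms_apply (ℓ : C(X, E →L[ℝ] ℝ)) (p : E) (x : X) :
    ContinuousMap.evalForms ℓ p x = ℓ x p := rfl

variable [CompactSpace X]

theorem ContinuousMap.norm_pow_le_pow_norm (f : C(X, ℝ)) (m : ℕ) : ‖f ^ m‖ ≤ ‖f‖ ^ m := by
  refine (ContinuousMap.norm_le _ (by positivity)).2 fun x => ?_
  rw [ContinuousMap.pow_apply, norm_pow]
  exact pow_le_pow_left₀ (norm_nonneg _) (f.norm_coe_le_norm x) m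

theorem ContinuousMap.summable_negBinomial (b : ℝ) {f : C(X, ℝ)} (hf : ‖f‖ < 1) :
    Summable (fun m => negBinomialCoeff b m • f ^ m) := by
  refine Summable.of_norm_bounded
    (summable_abs_negBinomialCoeff_mul_pow b (norm_nonneg f) hf) fun m => ?_
  rw [norm_smul, Real.norm_eq_abs]
  exact mul_le_mul_of_nonneg_left (f.norm_pow_le_pow_norm m) (abs_nonneg _)

theorem ContinuousMap.tsum_negBinomial_apply (b : ℝ) {f : C(X, ℝ)} (hf : ‖f‖ < 1) (x : X) :
    (∑' m, negBinomialCoeff b m • f ^ m) x = (1 - f x) ^ (-b) := by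
  rw [← ContinuousMap.tsum_apply (ContinuousMap.summable_negBinomial b hf)]
  exact (hasSum_negBinomial b ((f.norm_coe_le_norm x).trans_lt hf)).tsum_eq

theorem ContinuousMap.analyticAt_tsum_negBinomial (b : ℝ) :
    AnalyticAt ℝ (fun f : C(X, ℝ) => ∑' m, negBinomialCoeff b m • f ^ m) 0 := by
  set p := FormalMultilinearSeries.ofScalars C(X, ℝ) (negBinomialCoeff b)
  have hr : ((1 / 2 : NNReal) : ENNReal) ≤ p.radius := by
    apply FormalMultilinearSeries.le_radius_of_summable_norm
    refine Summable.of_norm_bounded_eventually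
      (summable_abs_negBinomialCoeff_mul_pow b (t := 1 / 2) (by norm_num) (by norm_num)) ?_
    filter_upwards [eventually_cofinite_ne 0] with m hm
    rw [Real.norm_eq_abs, abs_of_nonneg (by positivity)]
    gcongr
    · exact FormalMultilinearSeries.ofScalars_norm_le _ _ m (Nat.pos_of_ne_zero hm)
    · simp
  have h := (p.hasFPowerSeriesOnBall (lt_of_lt_of_le (by norm_num) hr)).analyticAt
  have e : p.sum = fun f : C(X, ℝ) => ∑' m, negBinomialCoeff b m • f ^ m := by
    funext f
    exact FormalMultilinearSeries.ofScalars_sum_eq _ _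
  rwa [e] at h

variable [MeasurableSpace X] [BorelSpace X] (μ : Measure X) [IsFiniteMeasure μ]

theorem ContinuousMap.integrable_of_isFiniteMeasure (f : C(X, ℝ)) : Integrable f μ :=
  f.continuous.integrable_of_hasCompactSupport (HasCompactSupport.of_compactSpace _)

/-- Integration of continuous functions against the density `V`. -/
noncomputable def ContinuousMap.integralMulCLM (V : C(X, ℝ)) : C(X, ℝ) →L[ℝ] ℝ :=
  LinearMap.mkContinuous
    { toFun := fun f => ∫ x, f x * V x ∂μ
      map_add' := fun f g => by
        simp only [ContinuousMap.add_apply, add_mul]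
        exact integral_add ((f * V).integrable_of_isFiniteMeasure μ)
          ((g * V).integrable_of_isFiniteMeasure μ)
      map_smul' := fun c f => by
        simp only [ContinuousMap.smul_apply, smul_eq_mul, mul_assoc, RingHom.id_apply]
        exact integral_const_mul _ _ }
    (‖V‖ * μ.real Set.univ) (fun f => by
      have h := norm_integral_le_of_norm_le_const (μ := μ) (f := fun x => f x * V x)
        (C := ‖f‖ * ‖V‖) (ae_of_all _ fun x => by
          rw [norm_mul]
          exact mul_le_mul (f.norm_coe_le_norm x) (V.norm_coe_le_norm x) (norm_nonneg _)
            (norm_nonneg _))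
      refine h.trans (le_of_eq ?_)
      ring)

theorem ContinuousMap.integralMulCLM_apply (V f : C(X, ℝ)) :
    ContinuousMap.integralMulCLM μ V f = ∫ x, f x * V x ∂μ := rfl

/-- The integral of `(1 - ℓ x p) ^ (-b)` against the density `V`, as a function of `p`. -/
noncomputable def binomialIntegral (ℓ : X → E →L[ℝ] ℝ) (b : ℝ) (V : X → ℝ) (p : E) : ℝ :=
  ∫ x, (1 - ℓ x p) ^ (-b) * V x ∂μ

theorem hasSum_binomialIntegral (ℓ : C(X, E →L[ℝ] ℝ)) (b : ℝ) (V : C(X, ℝ)) {p : E}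
    (hp : ∀ x, |ℓ x p| < 1) :
    HasSum (fun m => negBinomialCoeff b m * ∫ x, ℓ x p ^ m * V x ∂μ)
      (binomialIntegral μ ℓ b V p) := by
  have hf : ‖ContinuousMap.evalForms ℓ p‖ < 1 := by
    rw [ContinuousMap.norm_lt_iff _ one_pos]
    exact hp
  have h := ((ContinuousMap.summable_negBinomial b hf).hasSum).mapL
    (ContinuousMap.integralMulCLM μ V)
  rw [ContinuousMap.integralMulCLM_apply] at h
  simp only [ContinuousMap.tsum_negBinomial_apply b hf, map_smul, smul_eq_mul] at h
  exact h

theorem analyticAt_binomialIntegral_zero [FiniteDimensional ℝ E] (ℓ : C(X, E →L[ℝ] ℝ)) (b : ℝ)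
    (V : C(X, ℝ)) : AnalyticAt ℝ (binomialIntegral μ ℓ b V : E → ℝ) 0 := by
  let A : E →L[ℝ] C(X, ℝ) := LinearMap.toContinuousLinearMap
    { toFun := ContinuousMap.evalForms ℓ
      map_add' := fun p q => by ext x; simp [ContinuousMap.evalForms_apply]
      map_smul' := fun c p => by ext x; simp [ContinuousMap.evalForms_apply] }
  have hA : ∀ p, A p = ContinuousMap.evalForms ℓ p := fun p => rfl
  have h1 : AnalyticAt ℝ (fun p : E => ∑' m, negBinomialCoeff b m • (A p) ^ m) 0 := by
    have := ContinuousMap.analyticAt_tsum_negBinomial (X := X) b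
    rw [← map_zero A] at this
    exact this.comp (A.analyticAt 0)
  have h2 := ((ContinuousMap.integralMulCLM μ V).analyticAt _).comp h1
  refine h2.congr ?_
  have hn : ∀ᶠ p in 𝓝 (0 : E), ‖A p‖ < 1 :=
    (A.continuous.norm.tendsto' 0 0 (by simp)).eventually_lt_const one_pos
  filter_upwards [hn] with p hp
  simp only [Function.comp_apply, ContinuousMap.integralMulCLM_apply,
    ContinuousMap.tsum_negBinomial_apply b hp]
  rfl

theorem analyticAt_binomialIntegral [FiniteDimensional ℝ E] (ℓ : C(X, E →L[ℝ] ℝ)) (b : ℝ)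
    (V : C(X, ℝ)) {p : E} (hp : ∀ x, ℓ x p < 1) :
    AnalyticAt ℝ (binomialIntegral μ ℓ b V : E → ℝ) p := by
  have hs : ∀ x, 0 < 1 - ℓ x p := fun x => by linarith [hp x]
  let ℓ' : C(X, E →L[ℝ] ℝ) := ⟨fun x => (1 - ℓ x p)⁻¹ • ℓ x,
    (Continuous.inv₀ (by fun_prop) fun x => (hs x).ne').smul ℓ.continuous⟩
  let V' : C(X, ℝ) := ⟨fun x => (1 - ℓ x p) ^ (-b) * V x,
    (Continuous.rpow_const (by fun_prop) fun x => Or.inl (hs x).ne').mul V.continuous⟩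
  have h := analyticAt_binomialIntegral_zero μ ℓ' b V'
  rw [← sub_self p] at h
  have h2 := h.comp (f := fun q : E => q - p) (by fun_prop)
  refine h2.congr ?_
  have hn : ∀ᶠ q in 𝓝 p, ‖ContinuousMap.evalForms ℓ' (q - p)‖ < 1 := by
    have hc : Continuous fun q : E => ContinuousMap.evalForms ℓ' (q - p) := by
      refine ContinuousMap.continuous_of_continuous_uncurry _ ?_
      simp only [Function.uncurry_def, ContinuousMap.evalForms_apply]
      fun_prop
    refine (hc.norm.tendsto' p 0 ?_).eventually_lt_const one_pos
    rw [norm_eq_zero]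
    ext x
    simp [ContinuousMap.evalForms_apply]
  filter_upwards [hn] with q hq
  simp only [Function.comp_apply, binomialIntegral]
  refine integral_congr_ae (ae_of_all _ fun x => ?_)
  have hx : |ℓ' x (q - p)| < 1 :=
    ((ContinuousMap.evalForms ℓ' (q - p)).norm_coe_le_norm x).trans_lt hq
  have h0 : 0 ≤ 1 - ℓ' x (q - p) := by linarith [le_abs_self (ℓ' x (q - p))]
  have e : 1 - ℓ x q = (1 - ℓ' x (q - p)) * (1 - ℓ x p) := by
    have : ℓ' x (q - p) = (1 - ℓ x p)⁻¹ * (ℓ x q - ℓ x p) := by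
      simp [ℓ']
    rw [this]
    field_simp [(hs x).ne']
    ring
  change _ * ((1 - ℓ x p) ^ (-b) * V x) = (1 - ℓ x q) ^ (-b) * V x
  rw [e, Real.mul_rpow h0 (hs x).le, mul_assoc]

theorem hasLineDerivAt_binomialIntegral (ℓ : C(X, E →L[ℝ] ℝ)) (b : ℝ) (V : C(X, ℝ)) {p : E}
    (hp : ∀ x, ℓ x p < 1) (e : E) :
    HasLineDerivAt ℝ (binomialIntegral μ ℓ b V : E → ℝ)
      (b * binomialIntegral μ ℓ (b + 1) (fun x => ℓ x e * V x) p) p e := by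
  have hn : ∀ᶠ t : ℝ in 𝓝 0, ∀ x, ℓ x (p + t • e) < 1 := by
    have hU : IsOpen {q : ℝ | ∀ x, ℓ x (p + q • e) < 1} := by
      have : {q : ℝ | ∀ x, ℓ x (p + q • e) < 1}ᶜ
          = Prod.snd '' {z : X × ℝ | 1 ≤ ℓ z.1 (p + z.2 • e)} := by
        ext q; simp
      rw [← isClosed_compl_iff, this]
      exact isClosedMap_snd_of_compactSpace _ (isClosed_le continuous_const (by fun_prop))
    exact hU.mem_nhds (by simpa using hp)
  obtain ⟨ε, hε, hball⟩ := Metric.nhds_basis_closedBall.eventually_iff.1 hn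
  let F : ℝ → X → ℝ := fun t x => (1 - ℓ x (p + t • e)) ^ (-b) * V x
  let F' : ℝ → X → ℝ := fun t x => b * ((1 - ℓ x (p + t • e)) ^ (-(b + 1)) * (ℓ x e * V x))
  have hcont : ∀ c t : ℝ, (∀ x, ℓ x (p + t • e) < 1) →
      Continuous fun x => (1 - ℓ x (p + t • e)) ^ c := fun c t ht =>
    Continuous.rpow_const (by fun_prop) fun x => Or.inl (sub_pos.2 (ht x)).ne'
  have hint : ∀ f : X → ℝ, Continuous f → Integrable f μ := fun f hf =>
    ContinuousMap.integrable_of_isFiniteMeasure μ ⟨f, hf⟩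
  have hp0 : ∀ x, ℓ x (p + (0 : ℝ) • e) < 1 := by simpa using hp
  obtain ⟨C, hC⟩ : ∃ C, ∀ z ∈ (Set.univ : Set X) ×ˢ closedBall (0 : ℝ) ε,
      ‖F' z.2 z.1‖ ≤ C := by
    refine (isCompact_univ.prod (isCompact_closedBall (0 : ℝ) ε)).exists_bound_of_continuousOn ?_
    refine continuousOn_const.mul (ContinuousOn.mul (ContinuousOn.rpow_const (by fun_prop) ?_)
      (by fun_prop))
    exact fun z hz => Or.inl (sub_pos.2 (hball hz.2 z.1)).ne'
  have key := hasDerivAt_integral_of_dominated_loc_of_deriv_le (μ := μ) (F := F) (F' := F')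
    (x₀ := (0 : ℝ)) (s := closedBall 0 ε) (bound := fun _ => C)
    (closedBall_mem_nhds _ hε)
    (hn.mono fun t ht => (hint _ ((hcont (-b) t ht).mul V.continuous)).aestronglyMeasurable)
    (hint _ ((hcont (-b) 0 hp0).mul V.continuous))
    (hint _ (continuous_const.mul ((hcont (-(b + 1)) 0 hp0).mul (by fun_prop)))).aestronglyMeasurable
    (ae_of_all _ fun x t ht => hC (x, t) ⟨trivial, ht⟩) (integrable_const C)
    (ae_of_all _ fun x t ht => by
      have hpos : 1 - ℓ x (p + t • e) ≠ 0 := (sub_pos.2 (hball ht x)).ne'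
      have h1 : HasDerivAt (fun t : ℝ => 1 - ℓ x (p + t • e)) (-(ℓ x e)) t := by
        have : (fun t : ℝ => 1 - ℓ x (p + t • e)) = fun t => 1 - (ℓ x p + t * ℓ x e) := by
          funext t; simp
        rw [this]
        simpa using ((((hasDerivAt_id t).mul_const (ℓ x e)).const_add (ℓ x p)).const_sub 1)
      have h2 := (h1.rpow_const (p := -b) (Or.inl hpos)).mul_const (V x)
      convert! h2 using 1
      simp only [F']
      rw [neg_add']
      ring)
  have h := key.2
  simp only [F', zero_smul, add_zero] at h
  rw [integral_const_mul] at h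
  exact h

end BinomialIntegral

section MixedPartials

open Filter Topology

theorem partialDeriv_congr_of_eqOn {n : ℕ} {f g : EuclideanSpace ℝ (Fin n) → ℝ}
    {U : Set (EuclideanSpace ℝ (Fin n))} (hU : IsOpen U) (h : Set.EqOn f g U) (j : Fin n)
    {p : EuclideanSpace ℝ (Fin n)} (hp : p ∈ U) : partialDeriv j f p = partialDeriv j g p :=
  (h.eventuallyEq_of_mem (hU.mem_nhds hp)).lineDeriv_eq

theorem mixedPartial_congr_of_eqOn {n : ℕ} {f g : EuclideanSpace ℝ (Fin n) → ℝ}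
    {U : Set (EuclideanSpace ℝ (Fin n))} (hU : IsOpen U) (h : Set.EqOn f g U) (i : Fin n → ℕ) :
    Set.EqOn (mixedPartial i f) (mixedPartial i g) U := by
  unfold mixedPartial
  induction List.finRange n with
  | nil => exact h
  | cons j l ih =>
    simp only [List.foldr_cons]
    induction i j with
    | zero => exact ih
    | succ k ihk =>
      intro p hp
      simp only [Function.iterate_succ_apply']
      exact partialDeriv_congr_of_eqOn hU ihk j hp

/-- The `j`-th coordinate function of a continuous family of linear forms. -/
noncomputable def formCoord {X : Type*} [TopologicalSpace X] {n : ℕ}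
    (ℓ : C(X, EuclideanSpace ℝ (Fin n) →L[ℝ] ℝ)) (j : Fin n) : C(X, ℝ) :=
  ContinuousMap.evalForms ℓ (EuclideanSpace.single j 1)

variable {X : Type*} [TopologicalSpace X] [CompactSpace X] [MeasurableSpace X] [BorelSpace X]
  (μ : Measure X) [IsFiniteMeasure μ] {n : ℕ} (ℓ : C(X, EuclideanSpace ℝ (Fin n) →L[ℝ] ℝ))

theorem iterate_partialDeriv_binomialIntegral {U : Set (EuclideanSpace ℝ (Fin n))} (hU : IsOpen U)
    (hℓ : ∀ p ∈ U, ∀ x, ℓ x p < 1) (j : Fin n) (k : ℕ) (b c : ℝ) (V : C(X, ℝ))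
    {f : EuclideanSpace ℝ (Fin n) → ℝ}
    (hf : Set.EqOn f (fun p => c * binomialIntegral μ ℓ b V p) U) :
    Set.EqOn ((partialDeriv j)^[k] f)
      (fun p => c * (∏ r ∈ Finset.range k, (b + r)) *
        binomialIntegral μ ℓ (b + k) (formCoord ℓ j ^ k * V : C(X, ℝ)) p) U := by
  induction k with
  | zero => simpa using hf
  | succ k ih =>
    intro p hp
    rw [Function.iterate_succ_apply', partialDeriv_congr_of_eqOn hU ih j hp]
    have h := hasLineDerivAt_binomialIntegral μ ℓ (b + k) (formCoord ℓ j ^ k * V) (hℓ p hp)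
      (EuclideanSpace.single j 1)
    have h2 := HasDerivAt.const_mul (c * ∏ r ∈ Finset.range k, (b + r)) h
    have h3 : partialDeriv j (fun p => c * (∏ r ∈ Finset.range k, (b + r)) *
        binomialIntegral μ ℓ (b + k) (formCoord ℓ j ^ k * V : C(X, ℝ)) p) p = _ :=
      HasLineDerivAt.lineDeriv h2
    rw [h3, Finset.prod_range_succ]
    have e : (fun x => ℓ x (EuclideanSpace.single j 1) * (formCoord ℓ j ^ k * V : C(X, ℝ)) x)
        = (formCoord ℓ j ^ (k + 1) * V : C(X, ℝ)) := by
      funext x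
      simp only [ContinuousMap.mul_apply, ContinuousMap.pow_apply, formCoord,
        ContinuousMap.evalForms_apply]
      ring
    rw [e]
    push_cast
    rw [add_assoc b]
    ring

theorem mixedPartial_binomialIntegral {U : Set (EuclideanSpace ℝ (Fin n))} (hU : IsOpen U)
    (hℓ : ∀ p ∈ U, ∀ x, ℓ x p < 1) (i : Fin n → ℕ) (b : ℝ) (V : C(X, ℝ)) :
    Set.EqOn (mixedPartial i (binomialIntegral μ ℓ b V))
      (fun p => (∏ r ∈ Finset.range (∑ j, i j), (b + r)) *
        binomialIntegral μ ℓ (b + ∑ j, i j) ((∏ j, formCoord ℓ j ^ i j) * V : C(X, ℝ)) p) U := by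
  have key : ∀ l : List (Fin n), Set.EqOn
      (l.foldr (fun j h => (partialDeriv j)^[i j] h) (binomialIntegral μ ℓ b V))
      (fun p => (∏ r ∈ Finset.range (l.map i).sum, (b + r)) *
        binomialIntegral μ ℓ (b + (l.map i).sum)
          ((l.map fun j => formCoord ℓ j ^ i j).prod * V : C(X, ℝ)) p) U := by
    intro l
    induction l with
    | nil => intro p _; simp
    | cons j l ih =>
      have h := iterate_partialDeriv_binomialIntegral μ ℓ hU hℓ j (i j) _ _ _ ih
      intro p hp
      rw [List.foldr_cons, h hp]
      simp only [List.map_cons, List.sum_cons, List.prod_cons]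
      rw [add_comm (i j), Finset.prod_range_add]
      push_cast
      simp only [add_assoc, mul_assoc]
  have h := key (List.finRange n)
  rw [← List.ofFn_eq_map, ← List.ofFn_eq_map, List.sum_ofFn, List.prod_ofFn] at h
  exact_mod_cast h

end MixedPartials

section Taylor

theorem binomialIntegral_zero {X : Type*} [MeasurableSpace X] (μ : Measure X) {n : ℕ}
    (ℓ : X → EuclideanSpace ℝ (Fin n) →L[ℝ] ℝ) (b : ℝ) (V : X → ℝ) :
    binomialIntegral μ ℓ b V 0 = ∫ x, V x ∂μ := by
  simp [binomialIntegral]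

theorem form_eq_sum_formCoord {X : Type*} [TopologicalSpace X] {n : ℕ}
    (ℓ : C(X, EuclideanSpace ℝ (Fin n) →L[ℝ] ℝ)) (x : X) (p : EuclideanSpace ℝ (Fin n)) :
    ℓ x p = ∑ j, formCoord ℓ j x * p j := by
  have h := (EuclideanSpace.basisFun (Fin n) ℝ).sum_repr p
  conv_lhs => rw [← h]
  simp [formCoord, ContinuousMap.evalForms_apply, mul_comm]

variable {X : Type*} [TopologicalSpace X] [CompactSpace X] [MeasurableSpace X] [BorelSpace X]
  (μ : Measure X) [IsFiniteMeasure μ] {n : ℕ} (ℓ : C(X, EuclideanSpace ℝ (Fin n) →L[ℝ] ℝ))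

theorem integral_form_pow (V : C(X, ℝ)) (p : EuclideanSpace ℝ (Fin n)) (m : ℕ) :
    ∫ x, ℓ x p ^ m * V x ∂μ =
      ∑ i ∈ Finset.piAntidiag (Finset.univ : Finset (Fin n)) m,
        (m ! / ∏ j, ((i j)! : ℝ)) * (∫ x, (∏ j, formCoord ℓ j x ^ i j) * V x ∂μ) *
          ∏ j, p j ^ i j := by
  have h : ∀ x, ℓ x p ^ m * V x = ∑ i ∈ Finset.piAntidiag (Finset.univ : Finset (Fin n)) m,
      (((m ! / ∏ j, ((i j)! : ℝ)) * ∏ j, p j ^ i j) *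
        ((∏ j, formCoord ℓ j x ^ i j) * V x)) := by
    intro x
    rw [form_eq_sum_formCoord, Finset.sum_pow_eq_sum_piAntidiag, Finset.sum_mul]
    refine Finset.sum_congr rfl fun i hi => ?_
    have hm : (Nat.multinomial Finset.univ i : ℝ) = m ! / ∏ j, ((i j)! : ℝ) := by
      have h1 := Nat.multinomial_spec Finset.univ i
      rw [(Finset.mem_piAntidiag.1 hi).1] at h1
      rw [eq_div_iff (Finset.prod_ne_zero_iff.2 fun j _ => by positivity), ← h1]
      push_cast
      ring
    rw [hm]
    simp only [mul_pow, Finset.prod_mul_distrib]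
    ring
  simp only [h]
  rw [integral_finsetSum]
  · refine Finset.sum_congr rfl fun i _ => ?_
    rw [integral_const_mul]
    ring
  · intro i _
    have := ((∏ j, formCoord ℓ j ^ i j) * V : C(X, ℝ)).integrable_of_isFiniteMeasure μ
    refine Integrable.const_mul (this.congr (ae_of_all _ fun x => ?_)) _
    simp [ContinuousMap.prod_apply]

theorem hasSum_binomialIntegral_taylor (b : ℝ) (V : C(X, ℝ)) {p : EuclideanSpace ℝ (Fin n)}
    (hp : ∀ x, |ℓ x p| < 1) :
    HasSum (fun m : ℕ => ∑ i ∈ Finset.piAntidiag (Finset.univ : Finset (Fin n)) m,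
        (1 / ∏ j, ((i j)! : ℝ)) * ((∏ r ∈ Finset.range (∑ j, i j), (b + r)) *
          ∫ x, (∏ j, formCoord ℓ j x ^ i j) * V x ∂μ) * ∏ j, p j ^ i j)
      (binomialIntegral μ ℓ b V p) := by
  refine (hasSum_binomialIntegral μ ℓ b V hp).congr_fun fun m => ?_
  rw [integral_form_pow, Finset.mul_sum]
  refine Finset.sum_congr rfl fun i hi => ?_
  rw [(Finset.mem_piAntidiag.1 hi).1, negBinomialCoeff]
  have : (m ! : ℝ) ≠ 0 := by positivity
  field_simp

theorem areaCoeff_eq_prod (n m : ℕ) :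
    areaCoeff n m = ∏ r ∈ Finset.range m, (((n : ℝ) - 1) / 2 + r) := by
  rw [areaCoeff, ← Finset.card_range m, ← Finset.prod_const, Finset.card_range,
    ← Finset.prod_div_distrib]
  exact Finset.prod_congr rfl fun r _ => by ring

end Taylor

section Homogeneous

variable {E F : Type*} [NormedAddCommGroup E] [NormedSpace ℝ E] [NormedAddCommGroup F]
  [NormedSpace ℝ F]

theorem fderiv_apply_self_of_homogeneous {f : E → F} {x : E} (hf : DifferentiableAt ℝ f x)
    (h : ∀ t : ℝ, 0 < t → f (t • x) = t • f x) : fderiv ℝ f x x = f x := by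
  have h1 : HasDerivAt (fun t : ℝ => t • x) x 1 := by
    simpa using (hasDerivAt_id (1 : ℝ)).smul_const x
  have h2 : HasDerivAt (fun t : ℝ => f (t • x)) (fderiv ℝ f x x) 1 := by
    refine HasFDerivAt.comp_hasDerivAt (l := f) (1 : ℝ) ?_ h1
    simpa using hf.hasFDerivAt
  have h3 : HasDerivAt (fun t : ℝ => t • f x) (f x) 1 := by
    simpa using (hasDerivAt_id (1 : ℝ)).smul_const (f x)
  refine h2.unique (h3.congr_of_eventuallyEq ?_)
  filter_upwards [lt_mem_nhds (one_pos : (0 : ℝ) < 1)] with t ht using h t ht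

theorem fderiv_apply_self_of_homogeneous_zero {f : E → F} {x : E} (hf : DifferentiableAt ℝ f x)
    (h : ∀ t : ℝ, 0 < t → f (t • x) = f x) : fderiv ℝ f x x = 0 := by
  have h1 : HasDerivAt (fun t : ℝ => t • x) x 1 := by
    simpa using (hasDerivAt_id (1 : ℝ)).smul_const x
  have h2 : HasDerivAt (fun t : ℝ => f (t • x)) (fderiv ℝ f x x) 1 := by
    refine HasFDerivAt.comp_hasDerivAt (l := f) (1 : ℝ) ?_ h1
    simpa using hf.hasFDerivAt
  refine h2.unique ((hasDerivAt_const (1 : ℝ) (f x)).congr_of_eventuallyEq ?_)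
  filter_upwards [lt_mem_nhds (one_pos : (0 : ℝ) < 1)] with t ht using h t ht

theorem fderiv_smul_of_homogeneous {f : E → F} (h : ∀ t : ℝ, 0 < t → ∀ x, f (t • x) = t • f x)
    {t : ℝ} (ht : 0 < t) (x : E) : fderiv ℝ f (t • x) = fderiv ℝ f x := by
  have h1 : fderiv ℝ (fun y => f (t • y)) x = t • fderiv ℝ f (t • x) := fderiv_comp_smul t
  have h2 : (fun y => f (t • y)) = t • f := by
    funext y; exact h t ht y
  rw [h2, fderiv_const_smul_field] at h1
  exact (smul_right_injective _ ht.ne' h1).symm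

/-- A functional that is positive, positively homogeneous and differentiable away from zero. -/
structure IsDifferentiableGauge (N : E → ℝ) : Prop where
  map_smul : ∀ t : ℝ, 0 < t → ∀ x, N (t • x) = t * N x
  pos : ∀ x, x ≠ 0 → 0 < N x
  differentiableAt : ∀ x, x ≠ 0 → DifferentiableAt ℝ N x

theorem IsDifferentiableGauge.fderiv_apply_self {N : E → ℝ} (hN : IsDifferentiableGauge N) {x : E}
    (hx : x ≠ 0) : fderiv ℝ N x x = N x :=
  fderiv_apply_self_of_homogeneous (hN.differentiableAt x hx) fun t ht => hN.map_smul t ht x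

theorem IsDifferentiableGauge.fderiv_smul {N : E → ℝ} (hN : IsDifferentiableGauge N) {t : ℝ}
    (ht : 0 < t) (x : E) : fderiv ℝ N (t • x) = fderiv ℝ N x :=
  fderiv_smul_of_homogeneous hN.map_smul ht x

end Homogeneous

section Determinants

variable {n : ℕ}

theorem ContinuousLinearMap.det_smul_euclidean (c : ℝ)
    (A : EuclideanSpace ℝ (Fin n) →L[ℝ] EuclideanSpace ℝ (Fin n)) :
    (c • A).det = c ^ n * A.det := by
  simp [ContinuousLinearMap.det, LinearMap.det_smul]

theorem ContinuousLinearMap.det_comp_euclidean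
    (A B : EuclideanSpace ℝ (Fin n) →L[ℝ] EuclideanSpace ℝ (Fin n)) :
    (A.comp B).det = A.det * B.det := by
  simp [ContinuousLinearMap.det, LinearMap.det_comp]

theorem ContinuousLinearMap.det_id_add_smulRight (w : EuclideanSpace ℝ (Fin n) →L[ℝ] ℝ)
    (v : EuclideanSpace ℝ (Fin n)) :
    (ContinuousLinearMap.id ℝ (EuclideanSpace ℝ (Fin n)) + w.smulRight v).det = 1 + w v := by
  have h := LinearMap.transvection.det (w : EuclideanSpace ℝ (Fin n) →ₗ[ℝ] ℝ) v
  rw [ContinuousLinearMap.det, ← ContinuousLinearMap.coe_coe w, ← h]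
  congr 1

theorem IsDifferentiableGauge.hasFDerivAt_inv {N : EuclideanSpace ℝ (Fin n) → ℝ}
    (hN : IsDifferentiableGauge N) {x : EuclideanSpace ℝ (Fin n)} (hx : x ≠ 0) :
    HasFDerivAt (fun y => (N y)⁻¹) (-((N x) ^ 2)⁻¹ • fderiv ℝ N x) x :=
  (hasDerivAt_inv (hN.pos x hx).ne').comp_hasFDerivAt x (hN.differentiableAt x hx).hasFDerivAt

theorem IsDifferentiableGauge.det_frameMap {N : EuclideanSpace ℝ (Fin n) → ℝ}
    (hN : IsDifferentiableGauge N) {u : EuclideanSpace ℝ (Fin n)} (hu : ‖u‖ = 1) :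
    (frameMap (radialMap N) u).det = ((N u)⁻¹) ^ n := by
  have hu0 : u ≠ 0 := by rintro rfl; simp at hu
  have hd : fderiv ℝ (radialMap N) u =
      (N u)⁻¹ • ContinuousLinearMap.id ℝ _ + (-((N u) ^ 2)⁻¹ • fderiv ℝ N u).smulRight u :=
    ((hN.hasFDerivAt_inv hu0).smul (hasFDerivAt_id u)).fderiv
  set P := ContinuousLinearMap.id ℝ (EuclideanSpace ℝ (Fin n)) - (innerSL ℝ u).smulRight u
  have hPu : P u = 0 := by simp [P, hu]
  have e : frameMap (radialMap N) u = (N u)⁻¹ • (ContinuousLinearMap.id ℝ _ +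
      (-(N u)⁻¹ • (fderiv ℝ N u).comp P).smulRight u) := by
    rw [frameMap, hd]
    ext1 x
    simp only [P, radialMap, add_apply, ContinuousLinearMap.comp_apply,
      ContinuousLinearMap.smulRight_apply, smul_apply, ContinuousLinearMap.id_apply,
      sub_apply, smul_add, smul_sub, smul_smul, smul_eq_mul]
    module
  rw [e, ContinuousLinearMap.det_smul_euclidean, ContinuousLinearMap.det_id_add_smulRight]
  simp [hPu]

end Determinants

section Polar

variable {n : ℕ}

theorem integral_toSphere_eq (G : EuclideanSpace ℝ (Fin n) → ℝ) :
    ∫ u : sphere (0 : EuclideanSpace ℝ (Fin n)) 1, G u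
        ∂(volume : Measure (EuclideanSpace ℝ (Fin n))).toSphere =
      n * ∫ x in {x : EuclideanSpace ℝ (Fin n) | x ≠ 0 ∧ ‖x‖ < 1}, G (‖x‖⁻¹ • x) := by
  rcases Nat.eq_zero_or_pos n with rfl | hn
  · have : (volume : Measure (EuclideanSpace ℝ (Fin 0))).toSphere = 0 := by
      rw [Measure.toSphere_eq_zero_iff]; infer_instance
    simp [this]
  have : Nonempty (Fin n) := ⟨⟨0, hn⟩⟩
  let ρ : Set.Ioi (0 : ℝ) → ℝ :=
    (Set.Iio (⟨1, Set.mem_Ioi.2 one_pos⟩ : Set.Ioi (0 : ℝ))).indicator 1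
  have h1 : ∫ x in {x : EuclideanSpace ℝ (Fin n) | x ≠ 0 ∧ ‖x‖ < 1}, G (‖x‖⁻¹ • x) =
      ∫ x in ({0}ᶜ : Set (EuclideanSpace ℝ (Fin n))),
        (ball (0 : EuclideanSpace ℝ (Fin n)) 1).indicator (fun x => G (‖x‖⁻¹ • x)) x := by
    rw [setIntegral_indicator measurableSet_ball]
    congr 2
    ext x
    simp
  have h2 : ∫ x in ({0}ᶜ : Set (EuclideanSpace ℝ (Fin n))),
        (ball (0 : EuclideanSpace ℝ (Fin n)) 1).indicator (fun x => G (‖x‖⁻¹ • x)) x =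
      ∫ z : sphere (0 : EuclideanSpace ℝ (Fin n)) 1 × Set.Ioi (0 : ℝ), G z.1 * ρ z.2
        ∂(volume.toSphere.prod
          (.volumeIoiPow (Module.finrank ℝ (EuclideanSpace ℝ (Fin n)) - 1))) := by
    rw [← integral_subtype_comap (measurableSet_singleton _).compl,
      ← (volume : Measure (EuclideanSpace ℝ (Fin n))).measurePreserving_homeomorphUnitSphereProd.integral_comp
        (Homeomorph.measurableEmbedding _)]
    refine integral_congr_ae (ae_of_all _ fun x => ?_)
    simp only [ρ, Set.indicator_apply, Set.mem_Iio, ← Subtype.coe_lt_coe,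
      homeomorphUnitSphereProd_apply_snd_coe, homeomorphUnitSphereProd_apply_fst_coe, Pi.one_apply]
    by_cases hx : ‖(x : EuclideanSpace ℝ (Fin n))‖ < 1 <;> simp [hx]
  have h3 : ∫ r, ρ r ∂(Measure.volumeIoiPow (n - 1)) = 1 / n := by
    have hc : ((n - 1 : ℕ) : ℝ) + 1 = n := by
      rw [Nat.cast_pred hn]; ring
    simp only [ρ]
    rw [integral_indicator_one measurableSet_Iio, measureReal_def, Measure.volumeIoiPow_apply_Iio,
      ENNReal.toReal_ofReal (by positivity), hc]
    simp
  rw [h1, h2, integral_prod_mul (fun u : sphere (0 : EuclideanSpace ℝ (Fin n)) 1 => G u) ρ,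
    finrank_euclideanSpace_fin, h3]
  have : (n : ℝ) ≠ 0 := by positivity
  field_simp

theorem IsDifferentiableGauge.measurableSet_ne_zero_lt_one {N : EuclideanSpace ℝ (Fin n) → ℝ}
    (hN : IsDifferentiableGauge N) : MeasurableSet {x | x ≠ 0 ∧ N x < 1} := by
  have hc : ContinuousOn N {0}ᶜ := fun x hx =>
    (hN.differentiableAt x hx).continuousAt.continuousWithinAt
  exact (hc.isOpen_inter_preimage isOpen_compl_singleton isOpen_Iio).measurableSet

theorem isDifferentiableGauge_norm :
    IsDifferentiableGauge (fun x : EuclideanSpace ℝ (Fin n) => ‖x‖) where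
  map_smul t ht x := by rw [norm_smul, Real.norm_of_nonneg ht.le]
  pos x hx := norm_pos_iff.2 hx
  differentiableAt x hx := (contDiffAt_norm ℝ hx (n := 1)).differentiableAt (by simp)

theorem IsDifferentiableGauge.setIntegral_comp_normalize {N : EuclideanSpace ℝ (Fin n) → ℝ}
    (hN : IsDifferentiableGauge N) (h : EuclideanSpace ℝ (Fin n) → ℝ) :
    ∫ y in {y | y ≠ 0 ∧ N y < 1}, h ((N y)⁻¹ • y) =
      ∫ x in {x : EuclideanSpace ℝ (Fin n) | x ≠ 0 ∧ ‖x‖ < 1},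
        (‖x‖ * (N x)⁻¹) ^ n * h ((N x)⁻¹ • x) := by
  let lam : EuclideanSpace ℝ (Fin n) → ℝ := fun x => ‖x‖ * (N x)⁻¹
  have hlam : ∀ x, x ≠ 0 → 0 < lam x := fun x hx =>
    mul_pos (norm_pos_iff.2 hx) (inv_pos.2 (hN.pos x hx))
  have hlamd : ∀ x, x ≠ 0 → DifferentiableAt ℝ lam x := fun x hx =>
    (isDifferentiableGauge_norm.differentiableAt x hx).mul (hN.hasFDerivAt_inv hx).differentiableAt
  have hlam0 : ∀ t : ℝ, 0 < t → ∀ x, lam (t • x) = lam x := fun t ht x => by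
    simp only [lam, hN.map_smul t ht, norm_smul, Real.norm_of_nonneg ht.le]
    field_simp
  have hN' : ∀ x, x ≠ 0 → N (lam x • x) = ‖x‖ := fun x hx => by
    rw [hN.map_smul _ (hlam x hx)]
    simp [lam, (hN.pos x hx).ne']
  have himage : (fun x => lam x • x) '' {x | x ≠ 0 ∧ ‖x‖ < 1} = {y | y ≠ 0 ∧ N y < 1} := by
    ext y
    constructor
    · rintro ⟨x, ⟨hx, hx1⟩, rfl⟩
      exact ⟨smul_ne_zero (hlam x hx).ne' hx, by simpa only [hN' x hx] using hx1⟩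
    · rintro ⟨hy, hy1⟩
      have hp : 0 < (lam y)⁻¹ := inv_pos.2 (hlam y hy)
      refine ⟨(lam y)⁻¹ • y, ⟨smul_ne_zero hp.ne' hy, ?_⟩, ?_⟩
      · rw [norm_smul, Real.norm_of_nonneg hp.le]
        simpa [lam, (norm_pos_iff.2 hy).ne'] using hy1
      · simp only [hlam0 _ hp, smul_smul]
        rw [mul_inv_cancel₀ (hlam y hy).ne', one_smul]
  have hinj : Set.InjOn (fun x => lam x • x) {x | x ≠ 0 ∧ ‖x‖ < 1} := by
    rintro x ⟨hx, -⟩ y ⟨hy, -⟩ hxy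
    simp only at hxy
    have h1 : ‖x‖ = ‖y‖ := by rw [← hN' x hx, ← hN' y hy, hxy]
    have h2 : lam x = lam y := by
      have := congrArg norm hxy
      rw [norm_smul, norm_smul, Real.norm_of_nonneg (hlam x hx).le,
        Real.norm_of_nonneg (hlam y hy).le, h1] at this
      exact mul_right_cancel₀ (norm_pos_iff.2 hy).ne' this
    rw [h2] at hxy
    exact smul_right_injective _ (hlam y hy).ne' hxy
  have hderiv : ∀ x ∈ {x : EuclideanSpace ℝ (Fin n) | x ≠ 0 ∧ ‖x‖ < 1},
      HasFDerivWithinAt (fun x => lam x • x) (lam x • (ContinuousLinearMap.id ℝ _ +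
        ((lam x)⁻¹ • fderiv ℝ lam x).smulRight x)) {x | x ≠ 0 ∧ ‖x‖ < 1} x := by
    rintro x ⟨hx, -⟩
    have h1 := ((hlamd x hx).hasFDerivAt.smul (hasFDerivAt_id x)).hasFDerivWithinAt
      (s := {x | x ≠ 0 ∧ ‖x‖ < 1})
    have e : lam x • (ContinuousLinearMap.id ℝ _ + ((lam x)⁻¹ • fderiv ℝ lam x).smulRight x) =
        lam x • ContinuousLinearMap.id ℝ _ + (fderiv ℝ lam x).smulRight x := by
      ext1 v
      simp only [add_apply, smul_apply, ContinuousLinearMap.id_apply,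
        ContinuousLinearMap.smulRight_apply, smul_add, smul_smul, smul_eq_mul]
      rw [mul_inv_cancel_left₀ (hlam x hx).ne']
    rw [e]
    exact h1
  rw [← himage, integral_image_eq_integral_abs_det_fderiv_smul volume
    isDifferentiableGauge_norm.measurableSet_ne_zero_lt_one hderiv hinj]
  refine setIntegral_congr_fun isDifferentiableGauge_norm.measurableSet_ne_zero_lt_one ?_
  rintro x ⟨hx, -⟩
  have hdet : fderiv ℝ lam x x = 0 :=
    fderiv_apply_self_of_homogeneous_zero (hlamd x hx) fun t ht => hlam0 t ht x
  simp only [ContinuousLinearMap.det_smul_euclidean, ContinuousLinearMap.det_id_add_smulRight,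
    smul_apply, hdet, mul_zero, add_zero, mul_one, hN' x hx, smul_eq_mul, smul_smul]
  rw [abs_of_pos (pow_pos (hlam x hx) n)]
  have e : ‖x‖⁻¹ * lam x = (N x)⁻¹ := by
    simp [lam, (norm_pos_iff.2 hx).ne']
  rw [e]

/-- The integral over the indicatrix as a volume integral over the solid body. -/
theorem IsDifferentiableGauge.indicatrixIntegral_eq {N : EuclideanSpace ℝ (Fin n) → ℝ}
    (hN : IsDifferentiableGauge N) (f : EuclideanSpace ℝ (Fin n) → ℝ) :
    indicatrixIntegral N f = n * ∫ y in {y | y ≠ 0 ∧ N y < 1},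
      f ((N y)⁻¹ • y) * √(metricMatrix N ((N y)⁻¹ • y)).det := by
  rw [hN.setIntegral_comp_normalize (fun z => f z * √(metricMatrix N z).det), indicatrixIntegral]
  have h1 : ∀ u : sphere (0 : EuclideanSpace ℝ (Fin n)) 1,
      f (radialMap N u) * √(metricMatrix N (radialMap N u)).det *
        (frameMap (radialMap N) u).det =
      (fun u : EuclideanSpace ℝ (Fin n) => f (radialMap N u) *
        √(metricMatrix N (radialMap N u)).det * ((N u)⁻¹) ^ n) u := fun u => by
    rw [hN.det_frameMap (mem_sphere_zero_iff_norm.1 u.2)]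
  simp only [h1]
  rw [integral_toSphere_eq (fun u => f (radialMap N u) *
        √(metricMatrix N (radialMap N u)).det * ((N u)⁻¹) ^ n)]
  congr 1
  refine setIntegral_congr_fun isDifferentiableGauge_norm.measurableSet_ne_zero_lt_one ?_
  rintro x ⟨hx, -⟩
  have hx' : 0 < ‖x‖⁻¹ := inv_pos.2 (norm_pos_iff.2 hx)
  have e1 : (N (‖x‖⁻¹ • x))⁻¹ = ‖x‖ * (N x)⁻¹ := by
    rw [hN.map_smul _ hx', mul_inv, inv_inv]
  have e2 : radialMap N (‖x‖⁻¹ • x) = (N x)⁻¹ • x := by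
    rw [radialMap, e1, smul_smul, mul_right_comm, mul_inv_cancel₀ (norm_pos_iff.2 hx).ne', one_mul]
  simp only [e2]
  rw [e1]
  ring

end Polar

section EnergyGradient

open Filter Topology

variable {n : ℕ}

/-- The coordinate gradient of the energy. -/
noncomputable def energyGradient (N : EuclideanSpace ℝ (Fin n) → ℝ)
    (x : EuclideanSpace ℝ (Fin n)) : EuclideanSpace ℝ (Fin n) :=
  WithLp.toLp 2 fun i => partialDeriv i (energy N) x

theorem energyGradient_apply (N : EuclideanSpace ℝ (Fin n) → ℝ) (x : EuclideanSpace ℝ (Fin n))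
    (i : Fin n) : energyGradient N x i = partialDeriv i (energy N) x := rfl

theorem partialDeriv_energy {N : EuclideanSpace ℝ (Fin n) → ℝ} {x : EuclideanSpace ℝ (Fin n)}
    {A : EuclideanSpace ℝ (Fin n) →L[ℝ] ℝ} (hN : HasFDerivAt N A x) (i : Fin n) :
    partialDeriv i (energy N) x = N x * A (EuclideanSpace.single i 1) := by
  have h : HasFDerivAt (energy N) ((1 / 2 : ℝ) • ((2 * N x) • A)) x := by
    convert! (hN.pow 2).const_mul (1 / 2 : ℝ) using 1
    simp
  rw [partialDeriv, (h.hasLineDerivAt _).lineDeriv]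
  simp
  ring

theorem det_metricMatrix {N : EuclideanSpace ℝ (Fin n) → ℝ} {x : EuclideanSpace ℝ (Fin n)}
    (h : DifferentiableAt ℝ (energyGradient N) x) :
    (metricMatrix N x).det = (fderiv ℝ (energyGradient N) x).det := by
  rw [ContinuousLinearMap.det, ← LinearMap.det_toMatrix (EuclideanSpace.basisFun (Fin n) ℝ).toBasis]
  congr 1
  ext i j
  rw [LinearMap.toMatrix_apply]
  have h2 : HasFDerivAt (fun y => energyGradient N y i)
      ((EuclideanSpace.proj i : EuclideanSpace ℝ (Fin n) →L[ℝ] ℝ).comp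
        (fderiv ℝ (energyGradient N) x)) x :=
    (EuclideanSpace.proj i : EuclideanSpace ℝ (Fin n) →L[ℝ] ℝ).hasFDerivAt.comp x h.hasFDerivAt
  have h3 : metricMatrix N x i j = lineDeriv ℝ (fun y => energyGradient N y i) x
    (EuclideanSpace.single j 1) := rfl
  rw [h3, (h2.hasLineDerivAt _).lineDeriv]
  simp

theorem IsDifferentiableGauge.energyGradient_smul {N : EuclideanSpace ℝ (Fin n) → ℝ}
    (hN : IsDifferentiableGauge N) {x : EuclideanSpace ℝ (Fin n)} (hx : x ≠ 0) {t : ℝ}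
    (ht : 0 < t) : energyGradient N (t • x) = t • energyGradient N x := by
  ext i
  rw [energyGradient_apply, PiLp.smul_apply, energyGradient_apply,
    partialDeriv_energy (hN.differentiableAt _ (smul_ne_zero ht.ne' hx)).hasFDerivAt,
    partialDeriv_energy (hN.differentiableAt _ hx).hasFDerivAt, hN.fderiv_smul ht,
    hN.map_smul t ht, smul_eq_mul, mul_assoc]

theorem energyGradient_contDiffAt {N : EuclideanSpace ℝ (Fin n) → ℝ}
    {x : EuclideanSpace ℝ (Fin n)} {k : ℕ} (h : ContDiffAt ℝ (k + 1) N x) :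
    ContDiffAt ℝ k (energyGradient N) x := by
  rw [contDiffAt_euclidean]
  intro i
  have h1 : ContDiffAt ℝ k (fun y => N y * fderiv ℝ N y (EuclideanSpace.single i 1)) x :=
    (h.of_le (by exact_mod_cast k.le_succ)).mul
      ((h.fderiv_right le_rfl).clm_apply contDiffAt_const)
  refine h1.congr_of_eventuallyEq ?_
  filter_upwards [h.eventually (by exact_mod_cast ENat.natCast_ne_top _)] with y hy
  rw [energyGradient_apply, partialDeriv_energy (hy.differentiableAt (by simp)).hasFDerivAt]

end EnergyGradient

section Funk

open Filter Topology

variable {n : ℕ} {K : Set (EuclideanSpace ℝ (Fin n))}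

theorem IsFinslerMinkowskiBody.mem_nhds_zero (hK : IsFinslerMinkowskiBody K) :
    K ∈ 𝓝 (0 : EuclideanSpace ℝ (Fin n)) := mem_interior_iff_mem_nhds.1 hK.zero_mem_interior

theorem IsFinslerMinkowskiBody.isDifferentiableGauge (hK : IsFinslerMinkowskiBody K) :
    IsDifferentiableGauge (gauge K) where
  map_smul t ht x := gauge_smul_of_nonneg ht.le x
  pos x hx := (gauge_pos (absorbent_nhds_zero hK.mem_nhds_zero)
    (NormedSpace.isVonNBounded_iff ℝ |>.2 hK.isCompact.isBounded)).2 hx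
  differentiableAt x hx := (hK.contDiffAt x hx).differentiableAt (by simp)

theorem IsFinslerMinkowskiBody.gauge_add_le (hK : IsFinslerMinkowskiBody K)
    (x y : EuclideanSpace ℝ (Fin n)) : gauge K (x + y) ≤ gauge K x + gauge K y :=
  _root_.gauge_add_le hK.convex (absorbent_nhds_zero hK.mem_nhds_zero) x y

theorem IsFinslerMinkowskiBody.gauge_lt_one_iff (hK : IsFinslerMinkowskiBody K)
    {x : EuclideanSpace ℝ (Fin n)} : gauge K x < 1 ↔ x ∈ interior K :=
  gauge_lt_one_iff_mem_interior hK.convex hK.mem_nhds_zero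

theorem IsFinslerMinkowskiBody.gauge_le_one_iff (hK : IsFinslerMinkowskiBody K)
    {x : EuclideanSpace ℝ (Fin n)} : gauge K x ≤ 1 ↔ x ∈ K := by
  rw [gauge_le_one_iff_mem_closure hK.convex hK.mem_nhds_zero,
    hK.isCompact.isClosed.closure_eq]

theorem IsFinslerMinkowskiBody.fderiv_gauge_le (hK : IsFinslerMinkowskiBody K)
    {x : EuclideanSpace ℝ (Fin n)} (hx : x ≠ 0) (v : EuclideanSpace ℝ (Fin n)) :
    fderiv ℝ (gauge K) x v ≤ gauge K v := by
  have h1 : HasLineDerivAt ℝ (gauge K) (fderiv ℝ (gauge K) x v) x v :=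
    (hK.isDifferentiableGauge.differentiableAt x hx).hasFDerivAt.hasLineDerivAt v
  refine le_of_tendsto (f := fun t : ℝ => t⁻¹ • (gauge K (x + t • v) - gauge K x))
    (x := 𝓝[>] 0) ?_ ?_
  · exact h1.tendsto_slope_zero_right
  · filter_upwards [self_mem_nhdsWithin] with t ht
    have ht : 0 < t := ht
    have := hK.gauge_add_le x (t • v)
    rw [hK.isDifferentiableGauge.map_smul t ht] at this
    rw [smul_eq_mul, inv_mul_le_iff₀ ht]
    linarith

variable {p : EuclideanSpace ℝ (Fin n)}

theorem funkFunctional_body_mem_nhds (hp : p ∈ interior K) :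
    {v | p + v ∈ K} ∈ 𝓝 (0 : EuclideanSpace ℝ (Fin n)) := by
  have hc : ContinuousAt (fun v : EuclideanSpace ℝ (Fin n) => p + v) 0 := by fun_prop
  exact hc.preimage_mem_nhds (by simpa using mem_interior_iff_mem_nhds.1 hp)

theorem IsFinslerMinkowskiBody.funkFunctional_sub_gauge_smul (hK : IsFinslerMinkowskiBody K)
    (hp : p ∈ interior K) {x : EuclideanSpace ℝ (Fin n)} (hx : x ≠ 0) :
    funkFunctional K p (x - gauge K x • p) = gauge K x := by
  have hL := hK.isDifferentiableGauge.pos x hx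
  have hp1 := hK.gauge_lt_one_iff.2 hp
  refine le_antisymm (gauge_le_of_mem hL.le ?_) ?_
  · rw [Set.mem_smul_set_iff_inv_smul_mem₀ hL.ne']
    simp only [Set.mem_ofPred_eq, smul_sub, smul_smul, inv_mul_cancel₀ hL.ne', one_smul,
      add_sub_cancel]
    rw [← hK.gauge_le_one_iff, hK.isDifferentiableGauge.map_smul _ (inv_pos.2 hL),
      inv_mul_cancel₀ hL.ne']
  · by_contra! hlt
    obtain ⟨t, ht, hlt, hmem⟩ :=
      exists_lt_of_gauge_lt (absorbent_nhds_zero (funkFunctional_body_mem_nhds hp)) hlt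
    rw [Set.mem_smul_set_iff_inv_smul_mem₀ ht.ne'] at hmem
    have h1 : gauge K (p + t⁻¹ • (x - gauge K x • p)) ≤ 1 := hK.gauge_le_one_iff.2 hmem
    have h2 := hK.isDifferentiableGauge.map_smul t ht (p + t⁻¹ • (x - gauge K x • p))
    rw [smul_add, smul_inv_smul₀ ht.ne'] at h2
    have h3 := hK.gauge_add_le (t • p + (x - gauge K x • p)) ((gauge K x - t) • p)
    rw [hK.isDifferentiableGauge.map_smul _ (sub_pos.2 hlt)] at h3
    have e : t • p + (x - gauge K x • p) + (gauge K x - t) • p = x := by module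
    rw [e, h2] at h3
    nlinarith

theorem IsFinslerMinkowskiBody.sub_gauge_smul_ne_zero (hK : IsFinslerMinkowskiBody K)
    (hp : p ∈ interior K) {x : EuclideanSpace ℝ (Fin n)} (hx : x ≠ 0) :
    x - gauge K x • p ≠ 0 := by
  intro h
  have hL := hK.isDifferentiableGauge.pos x hx
  have h1 := hK.isDifferentiableGauge.map_smul _ hL p
  rw [← sub_eq_zero.1 h] at h1
  nlinarith [hK.gauge_lt_one_iff.2 hp]

theorem IsFinslerMinkowskiBody.continuous_gauge (hK : IsFinslerMinkowskiBody K) :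
    Continuous (gauge K) := _root_.continuous_gauge hK.convex hK.mem_nhds_zero

theorem IsFinslerMinkowskiBody.exists_sub_gauge_smul_eq (hK : IsFinslerMinkowskiBody K)
    (hp : p ∈ interior K) {v : EuclideanSpace ℝ (Fin n)} (hv : v ≠ 0) :
    ∃ x, x ≠ 0 ∧ x - gauge K x • p = v := by
  have hL := hK.isDifferentiableGauge.pos v hv
  have hp1 : 0 < 1 - gauge K p := sub_pos.2 (hK.gauge_lt_one_iff.2 hp)
  set M := gauge K v / (1 - gauge K p)
  have hM : 0 < M := div_pos hL hp1
  have hM1 : M * (1 - gauge K p) = gauge K v := div_mul_cancel₀ _ hp1.ne'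
  have hM2 := hK.gauge_add_le v (M • p)
  rw [hK.isDifferentiableGauge.map_smul M hM] at hM2
  have hc : ContinuousOn (fun t : ℝ => t - gauge K (v + t • p)) (Set.Icc 0 M) :=
    (continuous_id.sub (hK.continuous_gauge.comp (by fun_prop))).continuousOn
  obtain ⟨t, ⟨ht0, -⟩, ht⟩ := intermediate_value_Icc hM.le hc
    (show (0 : ℝ) ∈ _ from ⟨by simpa using hL.le, by nlinarith⟩)
  have ht' : gauge K (v + t • p) = t := by simp only at ht; linarith
  have hne : v + t • p ≠ 0 := by
    intro h0
    rw [h0, gauge_zero] at ht'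
    rw [← ht', zero_smul, add_zero] at h0
    exact hv h0
  exact ⟨v + t • p, hne, by rw [ht']; module⟩

theorem IsFinslerMinkowskiBody.continuous_funkFunctional (hK : IsFinslerMinkowskiBody K)
    (hp : p ∈ interior K) : Continuous (funkFunctional K p) :=
  _root_.continuous_gauge (hK.convex.translate_preimage_right p) (funkFunctional_body_mem_nhds hp)

theorem IsFinslerMinkowskiBody.one_sub_fderiv_gauge_pos (hK : IsFinslerMinkowskiBody K)
    (hp : p ∈ interior K) {x : EuclideanSpace ℝ (Fin n)} (hx : x ≠ 0) :
    0 < 1 - fderiv ℝ (gauge K) x p := by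
  linarith [hK.fderiv_gauge_le hx p, hK.gauge_lt_one_iff.2 hp]

/-- The derivative of `x ↦ x - L(x) p`. -/
noncomputable def shiftDeriv (K : Set (EuclideanSpace ℝ (Fin n))) (p x : EuclideanSpace ℝ (Fin n)) :
    EuclideanSpace ℝ (Fin n) →L[ℝ] EuclideanSpace ℝ (Fin n) :=
  ContinuousLinearMap.id ℝ _ + (-fderiv ℝ (gauge K) x).smulRight p

theorem det_shiftDeriv (K : Set (EuclideanSpace ℝ (Fin n))) (p x : EuclideanSpace ℝ (Fin n)) :
    (shiftDeriv K p x).det = 1 - fderiv ℝ (gauge K) x p := by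
  rw [shiftDeriv, ContinuousLinearMap.det_id_add_smulRight]
  simp [sub_eq_add_neg]

theorem IsFinslerMinkowskiBody.hasFDerivAt_shift (hK : IsFinslerMinkowskiBody K)
    (p : EuclideanSpace ℝ (Fin n)) {x : EuclideanSpace ℝ (Fin n)} (hx : x ≠ 0) :
    HasFDerivAt (fun x => x - gauge K x • p) (shiftDeriv K p x) x := by
  have h := (hasFDerivAt_id x).sub
    ((hK.isDifferentiableGauge.differentiableAt x hx).hasFDerivAt.smul_const p)
  have e : shiftDeriv K p x = ContinuousLinearMap.id ℝ _ - (fderiv ℝ (gauge K) x).smulRight p := by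
    ext1 v
    simp [shiftDeriv, sub_eq_add_neg]
  rw [e]
  exact h

/-- The inverse of the derivative of `x ↦ x - L(x) p`, for `x ≠ 0`. -/
theorem IsFinslerMinkowskiBody.exists_inverse_shiftDeriv (hK : IsFinslerMinkowskiBody K)
    (hp : p ∈ interior K) {x : EuclideanSpace ℝ (Fin n)} (hx : x ≠ 0) :
    ∃ B : EuclideanSpace ℝ (Fin n) →L[ℝ] EuclideanSpace ℝ (Fin n),
      (shiftDeriv K p x).comp B = ContinuousLinearMap.id ℝ _ ∧
      HasFDerivAt (fun v => v + funkFunctional K p v • p) B (x - gauge K x • p) := by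
  have hdet : (shiftDeriv K p x).det ≠ 0 := by
    rw [det_shiftDeriv]; exact (hK.one_sub_fderiv_gauge_pos hp hx).ne'
  let A := (shiftDeriv K p x).toContinuousLinearEquivOfDetNeZero hdet
  have hA : (A : EuclideanSpace ℝ (Fin n) →L[ℝ] EuclideanSpace ℝ (Fin n)) = shiftDeriv K p x :=
    ContinuousLinearMap.coe_toContinuousLinearEquivOfDetNeZero _ _
  refine ⟨A.symm, ?_, ?_⟩
  · rw [← hA]; exact A.coe_comp_coe_symm
  · refine HasFDerivAt.of_local_left_inverse (f := fun x => x - gauge K x • p) ?_ ?_ ?_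
    · exact (continuous_id.add
        ((hK.continuous_funkFunctional hp).smul continuous_const)).continuousAt
    · rw [hK.funkFunctional_sub_gauge_smul hp hx, sub_add_cancel, hA]
      exact hK.hasFDerivAt_shift p hx
    · filter_upwards [isOpen_compl_singleton.mem_nhds (hK.sub_gauge_smul_ne_zero hp hx)] with v hv
      obtain ⟨y, hy, rfl⟩ := hK.exists_sub_gauge_smul_eq hp hv
      rw [hK.funkFunctional_sub_gauge_smul hp hy, sub_add_cancel]

theorem IsFinslerMinkowskiBody.hasFDerivAt_funkFunctional (hK : IsFinslerMinkowskiBody K)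
    (hp : p ∈ interior K) {x : EuclideanSpace ℝ (Fin n)} (hx : x ≠ 0) :
    HasFDerivAt (funkFunctional K p)
      ((1 - fderiv ℝ (gauge K) x p)⁻¹ • fderiv ℝ (gauge K) x) (x - gauge K x • p) := by
  obtain ⟨B, hAB, hB⟩ := hK.exists_inverse_shiftDeriv hp hx
  have hS : x - gauge K x • p + funkFunctional K p (x - gauge K x • p) • p = x := by
    rw [hK.funkFunctional_sub_gauge_smul hp hx, sub_add_cancel]
  have hd : HasFDerivAt (gauge K) (fderiv ℝ (gauge K) x)
      (x - gauge K x • p + funkFunctional K p (x - gauge K x • p) • p) := by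
    rw [hS]; exact (hK.isDifferentiableGauge.differentiableAt x hx).hasFDerivAt
  have h := hd.comp (x - gauge K x • p) hB
  have e : (fderiv ℝ (gauge K) x).comp B =
      (1 - fderiv ℝ (gauge K) x p)⁻¹ • fderiv ℝ (gauge K) x := by
    have hs := (hK.one_sub_fderiv_gauge_pos hp hx).ne'
    have h1 : (fderiv ℝ (gauge K) x).comp (shiftDeriv K p x) =
        (1 - fderiv ℝ (gauge K) x p) • fderiv ℝ (gauge K) x := by
      ext1 v
      simp [shiftDeriv]
      ring
    have h2 : ((fderiv ℝ (gauge K) x).comp (shiftDeriv K p x)).comp B = fderiv ℝ (gauge K) x := by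
      rw [ContinuousLinearMap.comp_assoc, hAB, ContinuousLinearMap.comp_id]
    rw [h1, ContinuousLinearMap.smul_comp] at h2
    rw [← inv_smul_smul₀ hs ((fderiv ℝ (gauge K) x).comp B), h2]
  rw [e] at h
  refine h.congr_of_eventuallyEq ?_
  filter_upwards [isOpen_compl_singleton.mem_nhds (hK.sub_gauge_smul_ne_zero hp hx)] with v hv
  obtain ⟨y, hy, rfl⟩ := hK.exists_sub_gauge_smul_eq hp hv
  simp [hK.funkFunctional_sub_gauge_smul hp hy]

theorem IsFinslerMinkowskiBody.isDifferentiableGauge_funkFunctional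
    (hK : IsFinslerMinkowskiBody K) (hp : p ∈ interior K) :
    IsDifferentiableGauge (funkFunctional K p) where
  map_smul t ht x := gauge_smul_of_nonneg ht.le x
  pos v hv := by
    obtain ⟨x, hx, rfl⟩ := hK.exists_sub_gauge_smul_eq hp hv
    rw [hK.funkFunctional_sub_gauge_smul hp hx]
    exact hK.isDifferentiableGauge.pos x hx
  differentiableAt v hv := by
    obtain ⟨x, hx, rfl⟩ := hK.exists_sub_gauge_smul_eq hp hv
    exact (hK.hasFDerivAt_funkFunctional hp hx).differentiableAt

theorem IsFinslerMinkowskiBody.energyGradient_funkFunctional (hK : IsFinslerMinkowskiBody K)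
    (hp : p ∈ interior K) {x : EuclideanSpace ℝ (Fin n)} (hx : x ≠ 0) :
    energyGradient (funkFunctional K p) (x - gauge K x • p) =
      (1 - fderiv ℝ (gauge K) x p)⁻¹ • energyGradient (gauge K) x := by
  ext i
  rw [energyGradient_apply, PiLp.smul_apply, energyGradient_apply,
    partialDeriv_energy (hK.hasFDerivAt_funkFunctional hp hx),
    partialDeriv_energy (hK.isDifferentiableGauge.differentiableAt x hx).hasFDerivAt,
    hK.funkFunctional_sub_gauge_smul hp hx]
  simp
  ring

theorem IsFinslerMinkowskiBody.contDiffAt_energyGradient (hK : IsFinslerMinkowskiBody K)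
    {x : EuclideanSpace ℝ (Fin n)} (hx : x ≠ 0) : ContDiffAt ℝ 1 (energyGradient (gauge K)) x :=
  energyGradient_contDiffAt (k := 1) ((hK.contDiffAt x hx).of_le (by norm_num))

theorem IsFinslerMinkowskiBody.contDiffAt_fderiv_gauge (hK : IsFinslerMinkowskiBody K)
    {x : EuclideanSpace ℝ (Fin n)} (hx : x ≠ 0) : ContDiffAt ℝ 1 (fderiv ℝ (gauge K)) x :=
  (hK.contDiffAt x hx).fderiv_right (by norm_num)

theorem IsFinslerMinkowskiBody.det_metricMatrix_funkFunctional (hK : IsFinslerMinkowskiBody K)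
    (hp : p ∈ interior K) {x : EuclideanSpace ℝ (Fin n)} (hx : x ≠ 0) :
    (metricMatrix (funkFunctional K p) (x - gauge K x • p)).det =
      (1 - fderiv ℝ (gauge K) x p)⁻¹ ^ (n + 1) * (metricMatrix (gauge K) x).det := by
  obtain ⟨B, hAB, hB⟩ := hK.exists_inverse_shiftDeriv hp hx
  have hs := (hK.one_sub_fderiv_gauge_pos hp hx).ne'
  have hΓ := ((hK.contDiffAt_energyGradient hx).differentiableAt one_ne_zero)
  let σ : EuclideanSpace ℝ (Fin n) → ℝ := fun y => (1 - fderiv ℝ (gauge K) y p)⁻¹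
  have hσ : DifferentiableAt ℝ σ x := by
    have h1 : DifferentiableAt ℝ (fun y => fderiv ℝ (gauge K) y p) x :=
      ((hK.contDiffAt_fderiv_gauge hx).differentiableAt one_ne_zero).clm_apply
        (differentiableAt_const p)
    exact (h1.const_sub 1).inv hs
  have hσx : fderiv ℝ σ x x = 0 := fderiv_apply_self_of_homogeneous_zero hσ fun t ht => by
    simp only [σ, hK.isDifferentiableGauge.fderiv_smul ht]
  have hΓx : fderiv ℝ (energyGradient (gauge K)) x x = energyGradient (gauge K) x :=
    fderiv_apply_self_of_homogeneous hΓ fun t ht =>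
      hK.isDifferentiableGauge.energyGradient_smul hx ht
  set D := fderiv ℝ (energyGradient (gauge K)) x
  set C : EuclideanSpace ℝ (Fin n) →L[ℝ] EuclideanSpace ℝ (Fin n) := σ x • D.comp
    (ContinuousLinearMap.id ℝ _ + ((σ x)⁻¹ • fderiv ℝ σ x).smulRight x)
  have hσ0 : σ x ≠ 0 := inv_ne_zero hs
  have hC : HasFDerivAt (fun y => σ y • energyGradient (gauge K) y) C x := by
    have h := hσ.hasFDerivAt.smul hΓ.hasFDerivAt
    have e : C = σ x • D + (fderiv ℝ σ x).smulRight (energyGradient (gauge K) x) := by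
      ext1 v
      simp only [C, smul_apply, ContinuousLinearMap.comp_apply, add_apply,
        ContinuousLinearMap.id_apply, ContinuousLinearMap.smulRight_apply, map_add, map_smul,
        hΓx, smul_add, smul_smul, smul_eq_mul]
      rw [mul_inv_cancel_left₀ hσ0]
    rw [e]
    exact h
  have hS : x - gauge K x • p + funkFunctional K p (x - gauge K x • p) • p = x := by
    rw [hK.funkFunctional_sub_gauge_smul hp hx, sub_add_cancel]
  have hP : HasFDerivAt (energyGradient (funkFunctional K p)) (C.comp B)
      (x - gauge K x • p) := by
    have h := HasFDerivAt.comp (g := fun y => σ y • energyGradient (gauge K) y)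
      (x - gauge K x • p) (by rw [hS]; exact hC) hB
    refine h.congr_of_eventuallyEq ?_
    filter_upwards [isOpen_compl_singleton.mem_nhds (hK.sub_gauge_smul_ne_zero hp hx)] with v hv
    obtain ⟨y, hy, rfl⟩ := hK.exists_sub_gauge_smul_eq hp hv
    rw [hK.energyGradient_funkFunctional hp hy]
    simp [hK.funkFunctional_sub_gauge_smul hp hy, σ]
  have hdetB : B.det = σ x := by
    have h1 := congrArg ContinuousLinearMap.det hAB
    rw [ContinuousLinearMap.det_comp_euclidean, det_shiftDeriv] at h1
    have h2 : (ContinuousLinearMap.id ℝ (EuclideanSpace ℝ (Fin n))).det = 1 := by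
      simp [ContinuousLinearMap.det]
    rw [h2] at h1
    exact eq_inv_of_mul_eq_one_right h1
  rw [det_metricMatrix hP.differentiableAt, hP.fderiv, ContinuousLinearMap.det_comp_euclidean,
    hdetB, ContinuousLinearMap.det_smul_euclidean, ContinuousLinearMap.det_comp_euclidean,
    ContinuousLinearMap.det_id_add_smulRight, smul_apply, hσx, smul_zero, add_zero,
    mul_one, det_metricMatrix hΓ]
  simp only [σ]
  ring

end Funk

section FunkArea

open Filter Topology

variable {n : ℕ} {K : Set (EuclideanSpace ℝ (Fin n))} {p : EuclideanSpace ℝ (Fin n)}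

theorem mul_sqrt_inv_pow_succ {s : ℝ} (hs : 0 < s) (n : ℕ) :
    s * √(s⁻¹ ^ (n + 1)) = s ^ (-(((n : ℝ) - 1) / 2)) := by
  have h1 : √(s⁻¹ ^ (n + 1)) = s ^ (-(((n : ℝ) + 1) / 2)) := by
    rw [Real.sqrt_eq_rpow, ← Real.rpow_natCast, ← Real.rpow_mul (inv_pos.2 hs).le,
      Real.inv_rpow hs.le, ← Real.rpow_neg hs.le]
    push_cast
    ring_nf
  rw [h1]
  nth_rewrite 1 [← Real.rpow_one s]
  rw [← Real.rpow_add hs]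
  ring_nf

theorem IsFinslerMinkowskiBody.image_sub_gauge_smul (hK : IsFinslerMinkowskiBody K)
    (hp : p ∈ interior K) :
    (fun x => x - gauge K x • p) '' {x | x ≠ 0 ∧ gauge K x < 1} =
      {v | v ≠ 0 ∧ funkFunctional K p v < 1} := by
  ext v
  constructor
  · rintro ⟨x, ⟨hx, hx1⟩, rfl⟩
    exact ⟨hK.sub_gauge_smul_ne_zero hp hx, by
      rwa [hK.funkFunctional_sub_gauge_smul hp hx]⟩
  · rintro ⟨hv, hv1⟩
    obtain ⟨x, hx, rfl⟩ := hK.exists_sub_gauge_smul_eq hp hv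
    exact ⟨x, ⟨hx, by rwa [hK.funkFunctional_sub_gauge_smul hp hx] at hv1⟩, rfl⟩

/-- The area function of the Funk metric as an integral over the fixed indicatrix `∂K`. -/
theorem IsFinslerMinkowskiBody.funkArea_eq (hK : IsFinslerMinkowskiBody K)
    (hp : p ∈ interior K) :
    funkArea K p = indicatrixIntegral (gauge K)
      (fun y => (1 - fderiv ℝ (gauge K) y p) ^ (-(((n : ℝ) - 1) / 2))) := by
  have hL := hK.isDifferentiableGauge
  rw [funkArea, (hK.isDifferentiableGauge_funkFunctional hp).indicatrixIntegral_eq,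
    hL.indicatrixIntegral_eq, ← hK.image_sub_gauge_smul hp,
    integral_image_eq_integral_abs_det_fderiv_smul volume hL.measurableSet_ne_zero_lt_one
      (fun x hx => (hK.hasFDerivAt_shift p hx.1).hasFDerivWithinAt)]
  · congr 1
    refine setIntegral_congr_fun hL.measurableSet_ne_zero_lt_one ?_
    rintro x ⟨hx, -⟩
    have hs := hK.one_sub_fderiv_gauge_pos hp hx
    have hi : 0 < (gauge K x)⁻¹ := inv_pos.2 (hL.pos x hx)
    have hy : (gauge K x)⁻¹ • x ≠ 0 := smul_ne_zero hi.ne' hx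
    have e : (gauge K x)⁻¹ • (x - gauge K x • p) =
        (gauge K x)⁻¹ • x - gauge K ((gauge K x)⁻¹ • x) • p := by
      rw [hL.map_smul _ hi, smul_sub, smul_smul]
    simp only [det_shiftDeriv, hK.funkFunctional_sub_gauge_smul hp hx, smul_eq_mul, one_mul]
    rw [e, hK.det_metricMatrix_funkFunctional hp hy, hL.fderiv_smul hi, abs_of_pos hs,
      Real.sqrt_mul (by positivity), ← mul_assoc, mul_sqrt_inv_pow_succ hs]
  · rintro x ⟨hx, -⟩ y ⟨hy, -⟩ hxy
    simp only at hxy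
    have h := hK.funkFunctional_sub_gauge_smul hp hx
    rw [hxy, hK.funkFunctional_sub_gauge_smul hp hy] at h
    rw [h] at hxy
    exact sub_left_injective hxy

theorem IsFinslerMinkowskiBody.continuous_gauge_inv (hK : IsFinslerMinkowskiBody K) :
    Continuous fun u : sphere (0 : EuclideanSpace ℝ (Fin n)) 1 => (gauge K u)⁻¹ :=
  (hK.continuous_gauge.comp continuous_subtype_val).inv₀ fun u =>
    (hK.isDifferentiableGauge.pos u (ne_zero_of_mem_unit_sphere u)).ne'

/-- The differential of the Minkowski functional along the unit sphere. -/
noncomputable def IsFinslerMinkowskiBody.sphereForm (hK : IsFinslerMinkowskiBody K) :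
    C(sphere (0 : EuclideanSpace ℝ (Fin n)) 1, EuclideanSpace ℝ (Fin n) →L[ℝ] ℝ) :=
  ⟨fun u => fderiv ℝ (gauge K) u, continuous_iff_continuousAt.2 fun u =>
    (hK.contDiffAt_fderiv_gauge (ne_zero_of_mem_unit_sphere u)).continuousAt.comp
      continuous_subtype_val.continuousAt⟩

/-- The density of the indicatrix volume with respect to the surface measure of the unit sphere,
under the radial parametrization. -/
noncomputable def IsFinslerMinkowskiBody.sphereDensity (hK : IsFinslerMinkowskiBody K) :
    C(sphere (0 : EuclideanSpace ℝ (Fin n)) 1, ℝ) :=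
  ⟨fun u => √(metricMatrix (gauge K) (radialMap (gauge K) u)).det * ((gauge K u)⁻¹) ^ n, by
    refine Continuous.mul (Real.continuous_sqrt.comp ?_) (hK.continuous_gauge_inv.pow n)
    have hne : ∀ u : sphere (0 : EuclideanSpace ℝ (Fin n)) 1, radialMap (gauge K) u ≠ 0 := fun u =>
      smul_ne_zero (inv_ne_zero
        (hK.isDifferentiableGauge.pos u (ne_zero_of_mem_unit_sphere u)).ne')
        (ne_zero_of_mem_unit_sphere u)
    have hr : Continuous fun u : sphere (0 : EuclideanSpace ℝ (Fin n)) 1 =>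
        radialMap (gauge K) u := hK.continuous_gauge_inv.smul continuous_subtype_val
    have e : (fun u : sphere (0 : EuclideanSpace ℝ (Fin n)) 1 =>
        (metricMatrix (gauge K) (radialMap (gauge K) u)).det) =
        fun u : sphere (0 : EuclideanSpace ℝ (Fin n)) 1 =>
          (fderiv ℝ (energyGradient (gauge K)) (radialMap (gauge K) u)).det := by
      funext u
      exact det_metricMatrix ((hK.contDiffAt_energyGradient (hne u)).differentiableAt one_ne_zero)
    rw [e]
    refine ContinuousLinearMap.continuous_det.comp (continuous_iff_continuousAt.2 fun u => ?_)
    exact ContinuousAt.comp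
      (f := fun u : sphere (0 : EuclideanSpace ℝ (Fin n)) 1 => radialMap (gauge K) u)
      ((hK.contDiffAt_energyGradient (hne u)).fderiv_right (m := 0) (by norm_num)).continuousAt
      hr.continuousAt⟩

theorem IsFinslerMinkowskiBody.indicatrixIntegral_eq_sphere (hK : IsFinslerMinkowskiBody K)
    (f : EuclideanSpace ℝ (Fin n) → ℝ) :
    indicatrixIntegral (gauge K) f =
      ∫ u : sphere (0 : EuclideanSpace ℝ (Fin n)) 1, f (radialMap (gauge K) u) * hK.sphereDensity u
        ∂(volume : Measure (EuclideanSpace ℝ (Fin n))).toSphere := by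
  refine integral_congr_ae (ae_of_all _ fun u => ?_)
  simp only [hK.isDifferentiableGauge.det_frameMap (mem_sphere_zero_iff_norm.1 u.2), mul_assoc]
  rfl

theorem IsFinslerMinkowskiBody.fderiv_gauge_radialMap (hK : IsFinslerMinkowskiBody K)
    (u : sphere (0 : EuclideanSpace ℝ (Fin n)) 1) :
    fderiv ℝ (gauge K) (radialMap (gauge K) u) = hK.sphereForm u :=
  hK.isDifferentiableGauge.fderiv_smul
    (inv_pos.2 (hK.isDifferentiableGauge.pos u (ne_zero_of_mem_unit_sphere u))) _

theorem IsFinslerMinkowskiBody.partialDeriv_gauge_radialMap (hK : IsFinslerMinkowskiBody K)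
    (j : Fin n) (u : sphere (0 : EuclideanSpace ℝ (Fin n)) 1) :
    partialDeriv j (gauge K) (radialMap (gauge K) u) = formCoord hK.sphereForm j u := by
  have hu := inv_pos.2 (hK.isDifferentiableGauge.pos u (ne_zero_of_mem_unit_sphere u))
  have h := hK.isDifferentiableGauge.differentiableAt (radialMap (gauge K) u)
    (smul_ne_zero hu.ne' (ne_zero_of_mem_unit_sphere u))
  rw [partialDeriv, h.lineDeriv_eq_fderiv, hK.fderiv_gauge_radialMap]
  rfl

theorem IsFinslerMinkowskiBody.funkArea_eqOn (hK : IsFinslerMinkowskiBody K) :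
    Set.EqOn (funkArea K) (binomialIntegral
      (volume : Measure (EuclideanSpace ℝ (Fin n))).toSphere hK.sphereForm (((n : ℝ) - 1) / 2)
      hK.sphereDensity) (interior K) := by
  intro p hp
  rw [hK.funkArea_eq hp, hK.indicatrixIntegral_eq_sphere]
  simp only [hK.fderiv_gauge_radialMap]
  rfl

theorem IsFinslerMinkowskiBody.sphereForm_lt_one (hK : IsFinslerMinkowskiBody K) :
    ∀ p ∈ interior K, ∀ u, hK.sphereForm u p < 1 := fun p hp u =>
  (hK.fderiv_gauge_le (ne_zero_of_mem_unit_sphere u) p).trans_lt (hK.gauge_lt_one_iff.2 hp)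

theorem IsFinslerMinkowskiBody.analyticOnNhd_funkArea (hK : IsFinslerMinkowskiBody K) :
    AnalyticOnNhd ℝ (funkArea K) (interior K) := fun p hp =>
  (analyticAt_binomialIntegral _ hK.sphereForm _ hK.sphereDensity
    (hK.sphereForm_lt_one p hp)).congr
    (hK.funkArea_eqOn.symm.eventuallyEq_of_mem (isOpen_interior.mem_nhds hp))

theorem IsFinslerMinkowskiBody.mixedPartial_funkArea (hK : IsFinslerMinkowskiBody K)
    (i : Fin n → ℕ) :
    mixedPartial i (funkArea K) 0 =
      areaCoeff n (∑ j, i j) *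
        ∫ u, (∏ j, formCoord hK.sphereForm j u ^ i j) * hK.sphereDensity u
          ∂(volume : Measure (EuclideanSpace ℝ (Fin n))).toSphere := by
  rw [mixedPartial_congr_of_eqOn isOpen_interior hK.funkArea_eqOn i hK.zero_mem_interior,
    mixedPartial_binomialIntegral _ _ isOpen_interior hK.sphereForm_lt_one i _ _
      hK.zero_mem_interior]
  simp [binomialIntegral_zero, areaCoeff_eq_prod]

end FunkArea

theorem theorem3 (n : ℕ) (K : Set (EuclideanSpace ℝ (Fin n))) (hK : IsFinslerMinkowskiBody K) :
    AnalyticAt ℝ (funkArea K) 0 ∧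
    (∀ i : Fin n → ℕ,
      mixedPartial i (funkArea K) 0 =
        areaCoeff n (∑ j, i j) *
          indicatrixIntegral (gauge K) (fun y => ∏ j, (partialDeriv j (gauge K) y) ^ (i j))) ∧
    (∀ p ∈ interior (K ∩ -K),
      HasSum
        (fun m : ℕ => ∑ i ∈ Finset.piAntidiag (Finset.univ : Finset (Fin n)) m,
          (1 / ∏ j, ((i j)! : ℝ)) * mixedPartial i (funkArea K) 0 * ∏ j, (p j) ^ (i j))
        (funkArea K p)) ∧
    (-K = K → AnalyticOnNhd ℝ (funkArea K) (interior K)) := by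
  refine ⟨hK.analyticOnNhd_funkArea 0 hK.zero_mem_interior, fun i => ?_, fun p hp => ?_,
    fun _ => hK.analyticOnNhd_funkArea⟩
  · rw [hK.mixedPartial_funkArea, hK.indicatrixIntegral_eq_sphere]
    simp only [hK.partialDeriv_gauge_radialMap]
  · rw [interior_inter] at hp
    have hp' : -p ∈ interior K := by
      rw [← Set.mem_neg, ← Set.image_neg_eq_neg]
      have h := hp.2
      rwa [← Set.image_neg_eq_neg, ← Homeomorph.coe_neg, ← Homeomorph.image_interior,
        Homeomorph.coe_neg] at h
    rw [hK.funkArea_eqOn hp.1]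
    simp only [hK.mixedPartial_funkArea, areaCoeff_eq_prod]
    refine hasSum_binomialIntegral_taylor _ _ _ _ fun u =>
      abs_lt.2 ⟨?_, hK.sphereForm_lt_one p hp.1 u⟩
    have := hK.sphereForm_lt_one _ hp' u
    rw [map_neg] at this
    linarith
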